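/- Let $Q>0$ and let $f_0,f_1,f_2\ge 0$ with $f_0+f_1+f_2=1$ and $f_1\neq 1$; let $q(z)=f_0+f_1z+f_2z^2$, $q_1=q'(1)$, $q_2=q''(1)$. A random tree starts at time $0$ from one living node (the root). Every living node has an exponential lifetime $\tau$, $P(\tau\le t)=1-e^{-Qt}$; at the end of its life it becomes dead and is connected to $\nu\in\{0,1,2\}$ new living nodes, where $P(\nu=k)=f_k$; all lifetimes and all offspring numbers are independent. An end-node is a node without outgoing lines, i.e. a living node or a dead node with $\nu=0$; let $\mu(t,0)$ be the number of end-nodes at time $t$. Then there is a random variable $\tilde\mu_0$ with values in $\{0,1,2,\dots\}\cup\{\infty\}$ such that $\mu(t,0)\to\tilde\mu_0$ almost surely and $P(\mu(t,0)=n)\to P(\tilde\mu_0=n)=:p^{(0)}_n$ for every integer $n\ge 0$ as $t\to\infty$, and the following hold. (i) If $f_2\neq 0$, then for every complex $z$ with $|z|\le 1$ (with the principal square root) $$g_0(z)=\sum_{n=0}^\infty p^{(0)}_n z^n = 1+\frac{1}{2f_2}\left[1-f_1-2f_2-(1-f_1)\sqrt{1-\frac{4f_0f_2}{(1-f_1)^2}\,z}\;\right].$$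 (ii) $p^{(0)}_0=0$ and, for all $n\ge 1$ (with $0^0=1$), $$p^{(0)}_n=\frac{1}{\sqrt{\pi}}\,f_0\,\frac{\Gamma(n-1/2)}{\Gamma(n+1)}\,\frac{(4f_0f_2)^{n-1}}{(1-f_1)^{2n-1}}.$$ (iii) The probability of infinitely many end-nodes, $P(\tilde\mu_0=\infty)=1-\sum_{n\ge 0}p^{(0)}_n$, is $0$ if $q_1\le 1$ and equals $2(q_1-1)/q_2$ if $q_1>1$. -/

import Mathlib

open MeasureTheory ProbabilityTheory Filter Topology

namespace RandomTree

/-! Nodes of a tree carry Ulam-Harris labels, read from the root: `[]` is the root, and `i :: u` is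
the node reached by stepping from the root to its child number `i` (counted from `0`) and then
following `u`.  Each label `u` has a lifetime `τ u` and a number of offspring `ν u`. -/

/-- The label `u` belongs to the (full) genealogical tree with offspring numbers `ν`. -/
def IsNode (ν : List ℕ → ℕ) : List ℕ → Prop
  | [] => True
  | i :: u => i < ν [] ∧ IsNode (fun v => ν (i :: v)) u

/-- The time at which the node `u` is born: the sum of the lifetimes of its proper ancestors. -/
def birthTime (τ : List ℕ → ℝ) : List ℕ → ℝ
  | [] => 0
  | i :: u => τ [] + birthTime (fun v => τ (i :: v)) u

/-- The nodes that are alive at time `t`. -/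
def livingNodes (τ : List ℕ → ℝ) (ν : List ℕ → ℕ) (t : ℝ) : Set (List ℕ) :=
  {u | IsNode ν u ∧ birthTime τ u ≤ t ∧ t < birthTime τ u + τ u}

/-- The nodes that are dead at time `t` and have `k` outgoing lines; a node is connected to its
`ν u` offspring at the instant of its death. -/
def deadNodes (τ : List ℕ → ℝ) (ν : List ℕ → ℕ) (t : ℝ) (k : ℕ) : Set (List ℕ) :=
  {u | IsNode ν u ∧ birthTime τ u + τ u ≤ t ∧ ν u = k}

/-- The number `μ(t, 0)` of end-nodes (nodes without outgoing lines) at time `t`: all living nodes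
and the dead nodes without offspring. -/
noncomputable def endNodeCount (τ : List ℕ → ℝ) (ν : List ℕ → ℕ) (t : ℝ) : ℕ∞ :=
  (livingNodes τ ν t ∪ deadNodes τ ν t 0).encard

/-- `f` is a truncated distribution: a probability distribution on `{0, 1, 2}`. -/
structure IsTruncated (f : ℕ → ℝ) : Prop where
  nonneg : ∀ k, 0 ≤ f k
  eq_zero : ∀ k, 3 ≤ k → f k = 0
  sum_eq_one : f 0 + f 1 + f 2 = 1

/-- The generating function `q(z) = E z ^ ν` of the distribution `f`. -/
noncomputable def genFun (f : ℕ → ℝ) (z : ℝ) : ℝ := ∑' k : ℕ, f k * z ^ k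

/-- The factorial moments `q_j = q^{(j)}(1)` of the distribution `f`. -/
noncomputable def factorialMoment (f : ℕ → ℝ) (j : ℕ) : ℝ := iteratedDeriv j (genFun f) 1

/-- The family `(τ u, ν u)` drives the random tree evolution with rate `Q` and offspring
distribution `f`: lifetimes are exponential, `P(τ ≤ t) = 1 - e ^ (-Q t)`, offspring numbers have
distribution `f`, and all these variables are independent. -/
structure IsEvolution {Ω : Type*} [MeasurableSpace Ω] (P : Measure Ω) (Q : ℝ) (f : ℕ → ℝ)
    (τ : List ℕ → Ω → ℝ) (ν : List ℕ → Ω → ℕ) : Prop where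
  measurable_lifetime : ∀ u, Measurable (τ u)
  measurable_offspring : ∀ u, Measurable (ν u)
  law_lifetime : ∀ u t, 0 ≤ t → P.real {ω | τ u ω ≤ t} = 1 - Real.exp (-Q * t)
  law_offspring : ∀ u k, P.real {ω | ν u ω = k} = f k
  indep_lifetime_offspring : ∀ u, IndepFun (τ u) (ν u) P
  indep : iIndepFun (fun u ω => (τ u ω, ν u ω)) P

end RandomTree

namespace RandomTree

/-! ### The combinatorics of a fixed tree -/

lemma isNode_append_singleton (ν : List ℕ → ℕ) (u : List ℕ) (i : ℕ) :
    IsNode ν (u ++ [i]) ↔ IsNode ν u ∧ i < ν u := by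
  induction u generalizing ν with
  | nil => simp [IsNode]
  | cons j u ih => simp [IsNode, ih, and_assoc]

lemma birthTime_append_singleton (τ : List ℕ → ℝ) (u : List ℕ) (i : ℕ) :
    birthTime τ (u ++ [i]) = birthTime τ u + τ u := by
  induction u generalizing τ with
  | nil => simp [birthTime]
  | cons j u ih => simp [birthTime, ih, add_assoc]

lemma IsNode.lt_two {ν : List ℕ → ℕ} (hν : ∀ u, ν u ≤ 2) {u : List ℕ} (hu : IsNode ν u) :
    ∀ i ∈ u, i < 2 := by
  induction u generalizing ν with
  | nil => simp
  | cons j u ih =>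
    simp only [List.mem_cons, forall_eq_or_imp]
    exact ⟨hu.1.trans_le (hν _), ih (fun v => hν (j :: v)) hu.2⟩

/-- The nodes with two outgoing lines in the full genealogical tree. -/
def branchNodes (ν : List ℕ → ℕ) : Set (List ℕ) := {u | IsNode ν u ∧ ν u = 2}

/-- Every branching increases the number of end-nodes by one, the other deaths do not
change it. -/
theorem endNodeCount_eq_one_add {τ : List ℕ → ℝ} {ν : List ℕ → ℕ} {t : ℝ} (ht : 0 ≤ t)
    (hτ : ∀ u, 0 < τ u) (hν : ∀ u, ν u ≤ 2)
    (hfin : {u | IsNode ν u ∧ birthTime τ u ≤ t}.Finite) :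
    endNodeCount τ ν t = 1 + (deadNodes τ ν t 2).encard := by
  classical
  set T : Finset (List ℕ) := hfin.toFinset with hT
  have memT : ∀ u, u ∈ T ↔ IsNode ν u ∧ birthTime τ u ≤ t := fun u => by simp [hT]
  set D : Finset (List ℕ) := T.filter (fun u => birthTime τ u + τ u ≤ t) with hD
  have memD : ∀ u, u ∈ D ↔ IsNode ν u ∧ birthTime τ u + τ u ≤ t := fun u => by
    simp only [hD, Finset.mem_filter, memT]
    have := hτ u
    constructor
    · rintro ⟨⟨h1, h2⟩, h3⟩; exact ⟨h1, h3⟩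
    · rintro ⟨h1, h3⟩; exact ⟨⟨h1, by linarith⟩, h3⟩
  have hTD : T = insert [] (D.biUnion fun u => (Finset.range (ν u)).image fun i => u ++ [i]) := by
    ext u
    rcases u.eq_nil_or_concat' with rfl | ⟨v, i, rfl⟩
    · simp [memT, IsNode, birthTime, ht]
    · simp only [memT, isNode_append_singleton, birthTime_append_singleton, Finset.mem_insert,
        List.append_eq_nil_iff, List.cons_ne_self, and_false, false_or, Finset.mem_biUnion, memD,
        Finset.mem_image, Finset.mem_range]
      constructor
      · rintro ⟨⟨h1, h2⟩, h3⟩; exact ⟨v, ⟨h1, h3⟩, i, h2, rfl⟩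
      · rintro ⟨w, ⟨h1, h3⟩, j, h2, h⟩
        obtain ⟨rfl, rfl⟩ : w = v ∧ j = i := by simpa using h
        exact ⟨⟨h1, h2⟩, h3⟩
  have hcard : T.card = 1 + ∑ u ∈ D, ν u := by
    rw [hTD, Finset.card_insert_of_notMem (by simp), Finset.card_biUnion, add_comm]
    · congr 1
      refine Finset.sum_congr rfl fun u _ => ?_
      rw [Finset.card_image_of_injective _ (fun i j h => by simpa using h), Finset.card_range]
    · intro u _ v _ huv
      rw [Function.onFun, Finset.disjoint_left]
      intro w hw hw'
      simp only [Finset.mem_image, Finset.mem_range] at hw hw'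
      obtain ⟨i, _, rfl⟩ := hw
      obtain ⟨j, _, h⟩ := hw'
      exact huv (by simpa using (List.append_inj' h rfl).1.symm)
  have hE : livingNodes τ ν t ∪ deadNodes τ ν t 0 =
      (T.filter fun u => ¬ birthTime τ u + τ u ≤ t ∨ ν u = 0 : Finset (List ℕ)) := by
    ext u
    have := hτ u
    simp only [livingNodes, deadNodes, Set.mem_union, Set.mem_ofPred_eq, Finset.coe_filter, memT,
      not_le]
    constructor
    · rintro (⟨h1, h2, h3⟩ | ⟨h1, h2, h3⟩)
      · exact ⟨⟨h1, h2⟩, Or.inl h3⟩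
      · exact ⟨⟨h1, by linarith⟩, Or.inr h3⟩
    · rintro ⟨⟨h1, h2⟩, h3⟩
      by_cases h : t < birthTime τ u + τ u
      · exact Or.inl ⟨h1, h2, h⟩
      · exact Or.inr ⟨h1, not_lt.1 h, h3.resolve_left h⟩
  have hB : deadNodes τ ν t 2 =
      (T.filter fun u => birthTime τ u + τ u ≤ t ∧ ν u = 2 : Finset (List ℕ)) := by
    ext u
    have := hτ u
    simp only [deadNodes, Set.mem_ofPred_eq, Finset.coe_filter, memT]
    constructor
    · rintro ⟨h1, h2, h3⟩; exact ⟨⟨h1, by linarith⟩, h2, h3⟩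
    · rintro ⟨⟨h1, -⟩, h2, h3⟩; exact ⟨h1, h2, h3⟩
  rw [endNodeCount, hE, hB, Set.encard_coe_eq_coe_finsetCard, Set.encard_coe_eq_coe_finsetCard]
  have key : (T.filter fun u => ¬ birthTime τ u + τ u ≤ t ∨ ν u = 0).card + ∑ u ∈ D, ν u =
      T.card + (T.filter fun u => birthTime τ u + τ u ≤ t ∧ ν u = 2).card := by
    rw [hD, Finset.sum_filter, Finset.card_filter, Finset.card_filter, Finset.card_eq_sum_ones,
      ← Finset.sum_add_distrib, ← Finset.sum_add_distrib]
    refine Finset.sum_congr rfl fun u _ => ?_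
    have := hν u
    by_cases h : birthTime τ u + τ u ≤ t
    · simp only [h, not_true_eq_false, false_or, if_true, true_and]
      interval_cases ν u <;> simp
    · simp [h]
  norm_cast
  omega

lemma tendsto_encard_of_monotone {α : Type*} {S : ℝ → Set α} (hS : Monotone S) :
    Tendsto (fun t => (S t).encard) atTop (𝓝 (⋃ t, S t).encard) := by
  rw [tendsto_order]
  refine ⟨fun a ha => ?_, fun a ha => .of_forall fun t =>
    (Set.encard_le_encard (Set.subset_iUnion S t)).trans_lt ha⟩
  obtain ⟨F, hF, hcard⟩ := Set.exists_subset_encard_eq (Order.add_one_le_of_lt ha)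
  have hfin : F.Finite := Set.finite_of_encard_le_coe (k := (a + 1).toNat) (by
    rw [hcard, ENat.natCast_toNat]; simpa using (lt_of_lt_of_le ha le_top).ne)
  have : ∀ᶠ t in atTop, F ⊆ S t := by
    refine (hfin.eventually_all (l := atTop) (p := fun x t => x ∈ S t)).2 ?_
    intro x hx
    obtain ⟨t₀, h₀⟩ := Set.mem_iUnion.1 (hF hx)
    filter_upwards [eventually_ge_atTop t₀] with t h using hS h h₀
  filter_upwards [this] with t h
  refine lt_of_lt_of_le ?_ (Set.encard_le_encard h)
  rw [hcard]
  exact (ENat.lt_add_one_iff (lt_of_lt_of_le ha le_top).ne).2 le_rfl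

theorem tendsto_endNodeCount {τ : List ℕ → ℝ} {ν : List ℕ → ℕ}
    (hτ : ∀ u, 0 < τ u) (hν : ∀ u, ν u ≤ 2)
    (hfin : ∀ t : ℝ, {u | IsNode ν u ∧ birthTime τ u ≤ t}.Finite) :
    Tendsto (endNodeCount τ ν) atTop (𝓝 (1 + (branchNodes ν).encard)) := by
  have h1 : Monotone fun t => deadNodes τ ν t 2 := fun s t hst u hu =>
    ⟨hu.1, hu.2.1.trans hst, hu.2.2⟩
  have h2 : ⋃ t, deadNodes τ ν t 2 = branchNodes ν := by
    ext u
    simp only [deadNodes, branchNodes, Set.mem_iUnion, Set.mem_ofPred_eq]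
    exact ⟨fun ⟨t, h, _, h'⟩ => ⟨h, h'⟩, fun ⟨h, h'⟩ => ⟨_, h, le_rfl, h'⟩⟩
  have h3 := (tendsto_encard_of_monotone h1).const_add (1 : ℕ∞)
  rw [h2] at h3
  refine h3.congr' ?_
  filter_upwards [eventually_ge_atTop 0] with t ht
  exact (endNodeCount_eq_one_add ht hτ hν (hfin t)).symm

/-- The number of end-nodes of the stationary tree with offspring numbers `ν`. -/
noncomputable def finalCount (ν : List ℕ → ℕ) : ℕ∞ := 1 + (branchNodes ν).encard

lemma branchNodes_eq (ν : List ℕ → ℕ) : branchNodes ν =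
    {u | u = [] ∧ ν [] = 2} ∪
      ⋃ i ∈ Finset.range (ν []), List.cons i '' branchNodes fun v => ν (i :: v) := by
  ext u
  cases u with
  | nil => simp [branchNodes, IsNode]
  | cons i u =>
    simp only [branchNodes, IsNode, Set.mem_union, Set.mem_ofPred_eq, reduceCtorEq, false_and,
      false_or, Set.mem_iUnion, Finset.mem_range, Set.mem_image, exists_prop]
    constructor
    · rintro ⟨⟨h1, h2⟩, h3⟩; exact ⟨i, h1, u, ⟨h2, h3⟩, rfl⟩
    · rintro ⟨j, h1, v, ⟨h2, h3⟩, h⟩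
      obtain ⟨rfl, rfl⟩ : j = i ∧ v = u := by simpa using h
      exact ⟨⟨h1, h2⟩, h3⟩

lemma finalCount_of_eq_zero {ν : List ℕ → ℕ} (h : ν [] = 0) : finalCount ν = 1 := by
  rw [finalCount, branchNodes_eq]; simp [h]

lemma finalCount_of_eq_one {ν : List ℕ → ℕ} (h : ν [] = 1) :
    finalCount ν = finalCount fun v => ν (0 :: v) := by
  rw [finalCount, branchNodes_eq, finalCount]
  simp [h, List.cons_injective.encard_image]

lemma finalCount_of_eq_two {ν : List ℕ → ℕ} (h : ν [] = 2) :
    finalCount ν = finalCount (fun v => ν (0 :: v)) + finalCount fun v => ν (1 :: v) := by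
  rw [finalCount, branchNodes_eq, finalCount, finalCount]
  have : ⋃ i ∈ Finset.range (ν []), List.cons i '' (branchNodes fun v => ν (i :: v)) =
      List.cons 0 '' (branchNodes fun v => ν (0 :: v)) ∪
        List.cons 1 '' (branchNodes fun v => ν (1 :: v)) := by
    ext u; simp [h, Nat.le_one_iff_eq_zero_or_eq_one]
  rw [this, Set.encard_union_eq, Set.encard_union_eq, List.cons_injective.encard_image,
    List.cons_injective.encard_image]
  · simp only [h, and_true, Set.ofPred_eq_eq_singleton, Set.encard_singleton]
    ring
  · rw [Set.disjoint_left]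
    rintro _ ⟨u, _, rfl⟩ ⟨v, _, h⟩
    simp at h
  · rw [Set.disjoint_left]
    rintro _ ⟨rfl, _⟩ h
    simp at h

/-! ### Measurability -/

lemma measurableSet_isNode (u : List ℕ) : MeasurableSet {ν : List ℕ → ℕ | IsNode ν u} := by
  induction u with
  | nil => simp [IsNode]
  | cons i u ih =>
    simp only [IsNode]
    refine MeasurableSet.inter (measurableSet_lt measurable_const (measurable_pi_apply _)) ?_
    exact ih.preimage (f := fun (ν : List ℕ → ℕ) v => ν (i :: v))
      (measurable_pi_lambda _ fun v => measurable_pi_apply _)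

lemma measurable_birthTime (u : List ℕ) : Measurable fun τ : List ℕ → ℝ => birthTime τ u := by
  induction u with
  | nil => exact measurable_const
  | cons i u ih =>
    exact (measurable_pi_apply _).add
      (ih.comp (measurable_pi_lambda _ fun v => measurable_pi_apply (i :: v)))

lemma measurable_encard {α ι : Type*} [MeasurableSpace α] [Countable ι] {S : α → Set ι}
    (hS : ∀ i, MeasurableSet {a | i ∈ S a}) : Measurable fun a => (S a).encard := by
  have hle : ∀ n : ℕ, MeasurableSet {a | (n : ℕ∞) ≤ (S a).encard} := fun n => by
    have : {a | (n : ℕ∞) ≤ (S a).encard} =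
        ⋃ F ∈ {F : Finset ι | F.card = n}, ⋂ i ∈ F, {a | i ∈ S a} := by
      ext a
      simp only [Set.mem_ofPred_eq, Set.mem_iUnion, Set.mem_iInter, exists_prop]
      constructor
      · intro h
        obtain ⟨F, hF, hc⟩ := Set.exists_subset_encard_eq h
        have hfin : F.Finite := Set.finite_of_encard_le_coe hc.le
        refine ⟨hfin.toFinset, ?_, fun i hi => hF (by simpa using hi)⟩
        rw [hfin.encard_eq_coe_toFinset_card] at hc
        exact_mod_cast hc
      · rintro ⟨F, rfl, hF⟩
        rw [← Set.encard_coe_eq_coe_finsetCard]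
        exact Set.encard_le_encard hF
    rw [this]
    exact MeasurableSet.biUnion (Set.to_countable _) fun F _ =>
      Finset.measurableSet_biInter F fun i _ => hS i
  have heq : ∀ n : ℕ, MeasurableSet {a | (S a).encard = n} := fun n => by
    have : {a | (S a).encard = n} =
        {a | (n : ℕ∞) ≤ (S a).encard} \ {a | ((n + 1 : ℕ) : ℕ∞) ≤ (S a).encard} := by
      ext a
      simp only [Set.mem_ofPred_eq, Set.mem_sdiff, Nat.cast_add, Nat.cast_one,
        ENat.add_one_le_iff (ENat.natCast_ne_top n), not_lt]
      exact ⟨fun h => ⟨h.ge, h.le⟩, fun h => le_antisymm h.2 h.1⟩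
    rw [this]
    exact (hle n).diff (hle (n + 1))
  refine measurable_to_countable' fun x => ?_
  induction x using ENat.recTopCoe with
  | coe n => exact heq n
  | top =>
    have : (fun a => (S a).encard) ⁻¹' {⊤} = ⋂ n : ℕ, {a | (S a).encard = n}ᶜ := by
      ext a
      simp only [Set.mem_preimage, Set.mem_singleton_iff, Set.mem_iInter, Set.mem_compl_iff,
        Set.mem_ofPred_eq]
      exact ⟨fun h n => by simp [h], fun h => by
        by_contra h'
        obtain ⟨n, hn⟩ := ENat.ne_top_iff_exists.1 h'
        exact h n hn.symm⟩
    rw [this]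
    exact MeasurableSet.iInter fun n => (heq n).compl

lemma measurable_finalCount : Measurable finalCount := by
  refine (Measurable.of_discrete (f := fun x : ℕ∞ => 1 + x)).comp (measurable_encard fun u => ?_)
  exact (measurableSet_isNode u).inter (measurableSet_eq_fun (measurable_pi_apply u)
    measurable_const)

lemma measurable_endNodeCount {Ω : Type*} [MeasurableSpace Ω]
    {τ : List ℕ → Ω → ℝ} {ν : List ℕ → Ω → ℕ} (hτ : ∀ u, Measurable (τ u))
    (hν : ∀ u, Measurable (ν u)) (t : ℝ) :
    Measurable fun ω => endNodeCount (τ · ω) (ν · ω) t := by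
  refine measurable_encard fun u => ?_
  have h1 : MeasurableSet {ω | IsNode (ν · ω) u} :=
    (measurableSet_isNode u).preimage (measurable_pi_lambda _ hν)
  have h2 : Measurable fun ω => birthTime (τ · ω) u :=
    (measurable_birthTime u).comp (measurable_pi_lambda _ hτ)
  have h3 : Measurable fun ω => birthTime (τ · ω) u + τ u ω := h2.add (hτ u)
  exact (h1.inter ((measurableSet_le h2 measurable_const).inter
    (measurableSet_lt measurable_const h3))).union
    (h1.inter ((measurableSet_le h3 measurable_const).inter
      (measurableSet_eq_fun (hν u) measurable_const)))

/-! ### Families of independent variables indexed by the nodes -/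

section Independence

lemma comap_precomp_le {Ω β ι κ : Type*} [MeasurableSpace β] (X : ι → Ω → β) (g : κ → ι) :
    MeasurableSpace.comap (fun ω k => X (g k) ω) MeasurableSpace.pi ≤
      ⨆ i ∈ Set.range g, MeasurableSpace.comap (X i) inferInstance := by
  rw [MeasurableSpace.pi, MeasurableSpace.comap_iSup]
  refine iSup_le fun k => ?_
  rw [MeasurableSpace.comap_comp]
  exact le_iSup₂_of_le (g k) ⟨k, rfl⟩ le_rfl

variable {Ω β ι : Type*} [MeasurableSpace Ω] [MeasurableSpace β] {P : Measure Ω}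

lemma indepFun_precomp_of_disjoint_range {κ κ' : Type*} {X : ι → Ω → β}
    (hX : ∀ i, Measurable (X i)) (h : iIndepFun X P) (g : κ → ι) (g' : κ' → ι)
    (hg : Disjoint (Set.range g) (Set.range g')) :
    IndepFun (fun ω k => X (g k) ω) (fun ω k => X (g' k) ω) P := by
  have key := indep_iSup_of_disjoint (fun i => (hX i).comap_le) h.iIndep hg
  rw [IndepFun_iff_Indep]
  exact indep_of_indep_of_le_left (indep_of_indep_of_le_right key (comap_precomp_le X g'))
    (comap_precomp_le X g)

lemma map_precomp_eq_of_injective [IsProbabilityMeasure P] {X : ι → Ω → β}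
    (hX : ∀ i, Measurable (X i)) (h : iIndepFun X P) (hlaw : ∀ i j, P.map (X i) = P.map (X j))
    {g : ι → ι} (hg : g.Injective) :
    P.map (fun ω i => X (g i) ω) = P.map (fun ω i => X i ω) := by
  rw [h.map_fun_eq_infinitePi_map hX, (h.precomp hg).map_fun_eq_infinitePi_map (fun i => hX _)]
  congr 1
  exact funext fun i => hlaw _ _

end Independence

/-! ### The population remains finite at finite times -/

section Explosion

variable {Ω : Type*} [MeasurableSpace Ω] {P : Measure Ω}

lemma lintegral_exp_neg_birthTime_le [IsProbabilityMeasure P] {τ : List ℕ → Ω → ℝ}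
    (hτ : ∀ u, Measurable (τ u)) (h : iIndepFun τ P) {θ : ℝ} {r : ENNReal}
    (hr : ∀ u, ∫⁻ ω, ENNReal.ofReal (Real.exp (-θ * τ u ω)) ∂P ≤ r) (u : List ℕ) :
    ∫⁻ ω, ENNReal.ofReal (Real.exp (-θ * birthTime (τ · ω) u)) ∂P ≤ r ^ u.length := by
  induction u generalizing τ with
  | nil => simp [birthTime]
  | cons i u ih =>
    have hind := (indepFun_precomp_of_disjoint_range hτ h (fun _ : Unit => []) (List.cons i)
      (by simp)).comp
      (φ := fun x => ENNReal.ofReal (Real.exp (-θ * x ())))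
      (ψ := fun x => ENNReal.ofReal (Real.exp (-θ * birthTime x u)))
      (by fun_prop) (by have := measurable_birthTime u; fun_prop)
    have hb : Measurable fun ω => birthTime (fun v => τ (i :: v) ω) u :=
      (measurable_birthTime u).comp (measurable_pi_lambda _ fun v => hτ _)
    have hr0 := hτ []
    have := lintegral_mul_eq_lintegral_mul_lintegral_of_indepFun
      (by simp only [Function.comp_def]; fun_prop) (by simp only [Function.comp_def]; fun_prop)
      hind
    simp only [Function.comp_def, Pi.mul_apply] at this
    simp only [birthTime, mul_add, Real.exp_add, ENNReal.ofReal_mul (Real.exp_nonneg _)]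
    rw [this, List.length_cons, pow_succ']
    exact mul_le_mul' (hr []) (ih (fun v => hτ _) (h.precomp List.cons_injective) fun v => hr _)

lemma measure_birthTime_le [IsProbabilityMeasure P] {τ : List ℕ → Ω → ℝ}
    (hτ : ∀ u, Measurable (τ u)) (h : iIndepFun τ P) {θ : ℝ} (hθ : 0 ≤ θ) {r : ENNReal}
    (hr : ∀ u, ∫⁻ ω, ENNReal.ofReal (Real.exp (-θ * τ u ω)) ∂P ≤ r) (t : ℝ) (u : List ℕ) :
    P {ω | birthTime (τ · ω) u ≤ t} ≤ ENNReal.ofReal (Real.exp (θ * t)) * r ^ u.length := by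
  refine le_trans ?_ (mul_le_mul_right (lintegral_exp_neg_birthTime_le hτ h hr u) _)
  have hb : Measurable fun ω => birthTime (τ · ω) u :=
    (measurable_birthTime u).comp (measurable_pi_lambda _ hτ)
  rw [← lintegral_const_mul _ (by fun_prop), ← lintegral_indicator_one
    (measurableSet_le hb measurable_const)]
  refine lintegral_mono fun ω => ?_
  by_cases hω : birthTime (τ · ω) u ≤ t
  · rw [Set.indicator_of_mem (by exact hω), ← ENNReal.ofReal_mul (Real.exp_nonneg _),
      ← Real.exp_add, Pi.one_apply, ENNReal.one_le_ofReal, Real.one_le_exp_iff]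
    nlinarith
  · rw [Set.indicator_of_notMem (by exact hω)]
    positivity

lemma ae_finite_birthTime_le [IsProbabilityMeasure P] {τ : List ℕ → Ω → ℝ}
    (hτ : ∀ u, Measurable (τ u)) (h : iIndepFun τ P) {θ : ℝ} (hθ : 0 ≤ θ)
    (hr : ∀ u, ∫⁻ ω, ENNReal.ofReal (Real.exp (-θ * τ u ω)) ∂P ≤ 4⁻¹) (t : ℝ) :
    ∀ᵐ ω ∂P, {u | (∀ i ∈ u, i < 2) ∧ birthTime (τ · ω) u ≤ t}.Finite := by
  have hsum : ∑' w : List (Fin 2), P {ω | birthTime (τ · ω) (w.map Fin.val) ≤ t} ≠ ⊤ := by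
    refine ne_top_of_le_ne_top ?_ (ENNReal.tsum_le_tsum fun w =>
      measure_birthTime_le hτ h hθ hr t (w.map Fin.val))
    rw [ENNReal.tsum_mul_left]
    refine ENNReal.mul_ne_top ENNReal.ofReal_ne_top ?_
    rw [← List.equivSigmaTuple.symm.tsum_eq, ENNReal.tsum_sigma']
    have : ∀ n : ℕ, ∑' w : Fin n → Fin 2, (4⁻¹ : ENNReal) ^
        ((List.equivSigmaTuple.symm ⟨n, w⟩).map Fin.val).length = 2⁻¹ ^ n := by
      intro n
      simp only [List.length_map, List.equivSigmaTuple_symm_apply, List.length_ofFn, tsum_fintype,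
        Finset.sum_const, Finset.card_univ, Fintype.card_fun, Fintype.card_fin, nsmul_eq_mul,
        Nat.cast_pow, Nat.cast_ofNat]
      rw [← mul_pow, show (4 : ENNReal) = 2 * 2 by norm_num, ENNReal.mul_inv (by simp) (by simp),
        ← mul_assoc, ENNReal.mul_inv_cancel (by simp) (by simp), one_mul]
    simp_rw [this]
    rw [ENNReal.tsum_geometric]
    simp
  filter_upwards [ae_finite_setOfPred_mem hsum] with ω hω
  refine (hω.image (List.map Fin.val)).subset ?_
  rintro u ⟨h1, h2⟩
  have hu : (u.pmap (fun i hi => (⟨i, hi⟩ : Fin 2)) h1).map Fin.val = u := by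
    simp [List.map_pmap]
  refine ⟨u.pmap (fun i hi => ⟨i, hi⟩) h1, ?_, hu⟩
  simpa [hu] using h2

/-- The Laplace transform of a positive random variable is small far out. -/
lemma exists_lintegral_exp_neg_le {Q : ℝ} {ε : ENNReal} (hε : ε ≠ 0) :
    ∃ θ : ℝ, 0 ≤ θ ∧ ∀ (P : Measure Ω) [IsProbabilityMeasure P] (X : Ω → ℝ), Measurable X →
      (∀ t, 0 ≤ t → P.real {ω | X ω ≤ t} = 1 - Real.exp (-Q * t)) →
      ∫⁻ ω, ENNReal.ofReal (Real.exp (-θ * X ω)) ∂P ≤ ε := by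
  have hε2 : 0 < ε / 2 := ENNReal.half_pos hε
  obtain ⟨δ, hδ, hδ'⟩ : ∃ δ : ℝ, 0 < δ ∧ ENNReal.ofReal (1 - Real.exp (-Q * δ)) < ε / 2 := by
    have : Tendsto (fun δ => ENNReal.ofReal (1 - Real.exp (-Q * δ))) (𝓝[>] 0) (𝓝 0) := by
      have hc : Continuous fun δ => ENNReal.ofReal (1 - Real.exp (-Q * δ)) :=
        ENNReal.continuous_ofReal.comp (by fun_prop)
      simpa using (hc.tendsto 0).mono_left nhdsWithin_le_nhds
    exact (((this.eventually (gt_mem_nhds hε2)).and self_mem_nhdsWithin).exists).imp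
      fun δ h => ⟨h.2, h.1⟩
  obtain ⟨θ, hθ, hθ'⟩ : ∃ θ : ℝ, 0 ≤ θ ∧ ENNReal.ofReal (Real.exp (-θ * δ)) < ε / 2 := by
    have : Tendsto (fun θ : ℝ => ENNReal.ofReal (Real.exp (-θ * δ))) atTop (𝓝 0) := by
      rw [← ENNReal.ofReal_zero]
      refine ENNReal.tendsto_ofReal (Real.tendsto_exp_atBot.comp ?_)
      simp only [neg_mul]
      exact tendsto_neg_atTop_atBot.comp (tendsto_id.atTop_mul_const hδ)
    exact (((this.eventually (gt_mem_nhds hε2)).and (eventually_ge_atTop 0)).exists).imp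
      fun θ h => ⟨h.2, h.1⟩
  refine ⟨θ, hθ, fun P _ X hX hlaw => ?_⟩
  have hpos : ∀ᵐ ω ∂P, 0 < X ω := by
    have h0 := hlaw 0 le_rfl
    rw [mul_zero, Real.exp_zero, sub_self, measureReal_eq_zero_iff] at h0
    simpa [ae_iff] using h0
  calc ∫⁻ ω, ENNReal.ofReal (Real.exp (-θ * X ω)) ∂P
      ≤ ∫⁻ ω, ({ω | X ω ≤ δ}.indicator 1 ω + ENNReal.ofReal (Real.exp (-θ * δ))) ∂P := by
        refine lintegral_mono_ae ?_
        filter_upwards [hpos] with ω hω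
        by_cases h : X ω ≤ δ
        · rw [Set.indicator_of_mem (by exact h), Pi.one_apply]
          refine le_add_right ?_
          rw [ENNReal.ofReal_le_one, Real.exp_le_one_iff]
          nlinarith
        · refine le_add_left (ENNReal.ofReal_le_ofReal (Real.exp_le_exp.2 ?_))
          nlinarith
    _ = ENNReal.ofReal (1 - Real.exp (-Q * δ)) + ENNReal.ofReal (Real.exp (-θ * δ)) := by
        have hm : MeasurableSet {ω | X ω ≤ δ} := measurableSet_le hX measurable_const
        rw [lintegral_add_right _ measurable_const, lintegral_indicator_one hm, lintegral_const,
          measure_univ, mul_one, ← hlaw δ hδ.le, ofReal_measureReal]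
    _ ≤ ε / 2 + ε / 2 := add_le_add hδ'.le hθ'.le
    _ = ε := ENNReal.add_halves ε

end Explosion

section Evolution

variable {Ω : Type*} [MeasurableSpace Ω] {P : Measure Ω} {Q : ℝ} {f : ℕ → ℝ}
  {τ : List ℕ → Ω → ℝ} {ν : List ℕ → Ω → ℕ}

lemma IsEvolution.ae_pos [IsProbabilityMeasure P] (hev : IsEvolution P Q f τ ν) :
    ∀ᵐ ω ∂P, ∀ u, 0 < τ u ω := by
  refine ae_all_iff.2 fun u => ?_
  have h0 := hev.law_lifetime u 0 le_rfl
  rw [mul_zero, Real.exp_zero, sub_self, measureReal_eq_zero_iff] at h0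
  simpa [ae_iff] using h0

lemma IsEvolution.ae_le_two [IsProbabilityMeasure P] (hf : IsTruncated f)
    (hev : IsEvolution P Q f τ ν) : ∀ᵐ ω ∂P, ∀ u, ν u ω ≤ 2 := by
  refine ae_all_iff.2 fun u => ?_
  have : ∀ᵐ ω ∂P, ∀ k : ℕ, 3 ≤ k → ν u ω ≠ k := by
    refine ae_all_iff.2 fun k => ?_
    by_cases hk : 3 ≤ k
    · have h0 := hev.law_offspring u k
      rw [hf.eq_zero k hk, measureReal_eq_zero_iff] at h0
      simpa [ae_iff, hk] using h0
    · simp [hk]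
  filter_upwards [this] with ω hω
  by_contra h
  exact hω _ (by omega) rfl

lemma IsEvolution.ae_finite [IsProbabilityMeasure P] (hf : IsTruncated f)
    (hev : IsEvolution P Q f τ ν) :
    ∀ᵐ ω ∂P, ∀ t : ℝ, {u | IsNode (ν · ω) u ∧ birthTime (τ · ω) u ≤ t}.Finite := by
  obtain ⟨θ, hθ, H⟩ := exists_lintegral_exp_neg_le (Ω := Ω) (Q := Q) (ε := 4⁻¹) (by simp)
  have hind : iIndepFun τ P := hev.indep.comp (fun _ => Prod.fst) fun _ => measurable_fst
  have := ae_all_iff.2 fun n : ℕ => ae_finite_birthTime_le hev.measurable_lifetime hind hθ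
    (fun u => H P (τ u) (hev.measurable_lifetime u) (hev.law_lifetime u)) n
  filter_upwards [this, hev.ae_le_two hf] with ω hω h2 t
  obtain ⟨n, hn⟩ := exists_nat_ge t
  exact (hω n).subset fun u hu => ⟨hu.1.lt_two h2, hu.2.trans hn⟩

lemma IsEvolution.ae_tendsto_endNodeCount [IsProbabilityMeasure P] (hf : IsTruncated f)
    (hev : IsEvolution P Q f τ ν) :
    ∀ᵐ ω ∂P, Tendsto (fun t : ℝ => endNodeCount (τ · ω) (ν · ω) t) atTop
      (𝓝 (finalCount (ν · ω))) := by
  filter_upwards [hev.ae_pos, hev.ae_le_two hf, hev.ae_finite hf] with ω h1 h2 h3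
  exact tendsto_endNodeCount h1 h2 h3

lemma IsEvolution.tendsto_measureReal_endNodeCount [IsProbabilityMeasure P] (hf : IsTruncated f)
    (hev : IsEvolution P Q f τ ν) (n : ℕ) :
    Tendsto (fun t : ℝ => P.real {ω | endNodeCount (τ · ω) (ν · ω) t = n}) atTop
      (𝓝 (P.real {ω | finalCount (ν · ω) = n})) := by
  refine (ENNReal.tendsto_toReal (measure_ne_top _ _)).comp
    (tendsto_measure_of_ae_tendsto_indicator_of_isFiniteMeasure _ ?_ (fun t => ?_) ?_)
  · exact (measurable_finalCount.comp (measurable_pi_lambda _ hev.measurable_offspring))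
      (measurableSet_singleton _)
  · exact measurable_endNodeCount hev.measurable_lifetime hev.measurable_offspring t
      (measurableSet_singleton _)
  · filter_upwards [hev.ae_tendsto_endNodeCount hf] with ω hω
    by_cases h : finalCount (ν · ω) = n
    · rw [h, ENat.nhds_natCast, tendsto_pure] at hω
      filter_upwards [hω] with t ht
      simp [ht, h]
    · have : {(n : ℕ∞)}ᶜ ∈ 𝓝 (finalCount (ν · ω)) := isOpen_compl_singleton.mem_nhds h
      filter_upwards [hω.eventually this] with t ht
      exact ⟨fun h' => absurd h' ht, fun h' => absurd h' h⟩

/-- The law of the final number of end-nodes, decomposed at the root. -/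
lemma IsEvolution.measureReal_finalCount [IsProbabilityMeasure P] (hf : IsTruncated f)
    (hev : IsEvolution P Q f τ ν) (n : ℕ) :
    P.real {ω | finalCount (ν · ω) = n} =
      (if n = 1 then f 0 else 0) + f 1 * P.real {ω | finalCount (ν · ω) = n} +
        f 2 * ∑ ij ∈ Finset.HasAntidiagonal.antidiagonal n, P.real {ω | finalCount (ν · ω) = ij.1} *
          P.real {ω | finalCount (ν · ω) = ij.2} := by
  have hm := hev.measurable_offspring
  have hind : iIndepFun ν P := hev.indep.comp (fun _ => Prod.snd) fun _ => measurable_snd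
  have hlaw : ∀ u v, P.map (ν u) = P.map (ν v) := fun u v => by
    refine Measure.ext_of_singleton fun k => ?_
    rw [Measure.map_apply (hm u) (measurableSet_singleton k),
      Measure.map_apply (hm v) (measurableSet_singleton k)]
    exact (measureReal_eq_measureReal_iff (measure_ne_top _ _) (measure_ne_top _ _)).1
      ((hev.law_offspring u k).trans (hev.law_offspring v k).symm)
  set N : ℕ → Ω → ℕ∞ := fun i ω => finalCount fun v => ν (i :: v) ω with hN
  have hNm : ∀ i, Measurable (N i) := fun i =>
    measurable_finalCount.comp (measurable_pi_lambda _ fun v => hm (i :: v))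
  have hNlaw : ∀ i (k : ℕ), P.real {ω | N i ω = k} = P.real {ω | finalCount (ν · ω) = k} := by
    intro i k
    have h := congrArg (fun μ => μ.real {x | finalCount x = k})
      (map_precomp_eq_of_injective hm hind hlaw (List.cons_injective (a := i)))
    have hk : MeasurableSet {x | finalCount x = k} :=
      measurable_finalCount (measurableSet_singleton _)
    rwa [map_measureReal_apply (measurable_pi_lambda _ fun v => hm _) hk,
      map_measureReal_apply (measurable_pi_lambda _ hm) hk] at h
  have h01 : IndepFun (N 0) (N 1) P :=
    (indepFun_precomp_of_disjoint_range hm hind (List.cons 0) (List.cons 1)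
      (by simp [Set.disjoint_left])).comp measurable_finalCount measurable_finalCount
  have hroot : IndepFun (ν []) (fun ω => (N 0 ω, N 1 ω)) P :=
    (indepFun_precomp_of_disjoint_range hm hind (fun _ : Unit => [])
      (fun p : ℕ × List ℕ => p.1 :: p.2) (by simp)).comp
      (φ := fun x : Unit → ℕ => x ())
      (ψ := fun x : ℕ × List ℕ → ℕ => (finalCount fun v => x (0, v), finalCount fun v => x (1, v)))
      (measurable_pi_apply _)
      ((measurable_finalCount.comp (measurable_pi_lambda _ fun v => measurable_pi_apply _)).prodMk
        (measurable_finalCount.comp (measurable_pi_lambda _ fun v => measurable_pi_apply _)))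
  have hsplit : ∀ k (A : Set (ℕ∞ × ℕ∞)), P.real {ω | ν [] ω = k ∧ (N 0 ω, N 1 ω) ∈ A} =
      f k * P.real {ω | (N 0 ω, N 1 ω) ∈ A} := fun k A => by
    rw [← hev.law_offspring [] k, measureReal_def, measureReal_def, measureReal_def,
      ← ENNReal.toReal_mul]
    congr 1
    exact hroot.measure_inter_preimage_eq_mul {k} A (measurableSet_singleton k)
      A.to_countable.measurableSet
  have hprod : ∀ i j : ℕ, P.real {ω | N 0 ω = i ∧ N 1 ω = j} =
      P.real {ω | finalCount (ν · ω) = i} * P.real {ω | finalCount (ν · ω) = j} := fun i j => by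
    rw [← hNlaw 0 i, ← hNlaw 1 j, measureReal_def, measureReal_def, measureReal_def,
      ← ENNReal.toReal_mul]
    congr 1
    exact h01.measure_inter_preimage_eq_mul {(i : ℕ∞)} {(j : ℕ∞)} (measurableSet_singleton _)
      (measurableSet_singleton _)
  have hNmeas : ∀ A : Set (ℕ∞ × ℕ∞), MeasurableSet {ω | (N 0 ω, N 1 ω) ∈ A} := fun A =>
    ((hNm 0).prodMk (hNm 1)) A.to_countable.measurableSet
  have hνmeas : ∀ k, MeasurableSet {ω | ν [] ω = k} := fun k => hm [] (measurableSet_singleton k)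
  have hsum : P.real {ω | N 0 ω + N 1 ω = n} =
      ∑ ij ∈ Finset.HasAntidiagonal.antidiagonal n, P.real {ω | finalCount (ν · ω) = ij.1} *
          P.real {ω | finalCount (ν · ω) = ij.2} := by
    have : {ω | N 0 ω + N 1 ω = n} =
        ⋃ ij ∈ Finset.HasAntidiagonal.antidiagonal n, {ω | N 0 ω = ij.1 ∧ N 1 ω = ij.2} := by
      ext ω
      simp only [Set.mem_ofPred_eq, Set.mem_iUnion, Finset.HasAntidiagonal.mem_antidiagonal, exists_prop]
      constructor
      · intro h
        have h0 : N 0 ω ≠ ⊤ := fun h' => by simp [h'] at h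
        have h1 : N 1 ω ≠ ⊤ := fun h' => by simp [h'] at h
        obtain ⟨i, hi⟩ := ENat.ne_top_iff_exists.1 h0
        obtain ⟨j, hj⟩ := ENat.ne_top_iff_exists.1 h1
        rw [← hi, ← hj] at h
        exact ⟨(i, j), by exact_mod_cast h, hi.symm, hj.symm⟩
      · rintro ⟨ij, h, h0, h1⟩
        rw [h0, h1, ← h, Nat.cast_add]
    rw [this, measureReal_biUnion_finset]
    · exact Finset.sum_congr rfl fun ij _ => hprod _ _
    · intro a _ b _ hab
      rw [Function.onFun, Set.disjoint_left]
      rintro ω ⟨h1, h2⟩ ⟨h3, h4⟩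
      rw [h1] at h3
      rw [h2] at h4
      exact hab (Prod.ext (by exact_mod_cast h3) (by exact_mod_cast h4))
    · exact fun ij _ => (hNm 0 (measurableSet_singleton _)).inter
        (hNm 1 (measurableSet_singleton _))
  have hdec : P.real {ω | finalCount (ν · ω) = n} =
      P.real ({ω | ν [] ω = 0 ∧ (N 0 ω, N 1 ω) ∈ {_x : ℕ∞ × ℕ∞ | n = 1}} ∪
        {ω | ν [] ω = 1 ∧ (N 0 ω, N 1 ω) ∈ {x : ℕ∞ × ℕ∞ | x.1 = n}} ∪
        {ω | ν [] ω = 2 ∧ (N 0 ω, N 1 ω) ∈ {x : ℕ∞ × ℕ∞ | x.1 + x.2 = n}}) := by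
    refine measureReal_congr ?_
    filter_upwards [hev.ae_le_two hf] with ω hω
    refine propext ?_
    have h2 := hω []
    change finalCount (ν · ω) = n ↔ (((ν [] ω = 0 ∧ n = 1) ∨ (ν [] ω = 1 ∧ N 0 ω = n)) ∨
      (ν [] ω = 2 ∧ N 0 ω + N 1 ω = n))
    obtain h | h | h : ν [] ω = 0 ∨ ν [] ω = 1 ∨ ν [] ω = 2 := by omega
    · rw [finalCount_of_eq_zero h]
      simp only [h, true_and]
      norm_num
      exact_mod_cast eq_comm
    · rw [finalCount_of_eq_one h]
      simp [h, hN]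
    · rw [finalCount_of_eq_two h]
      simp [h, hN]
  conv_lhs => rw [hdec]
  rw [measureReal_union, measureReal_union, hsplit, hsplit, hsplit]
  · congr 1
    · congr 1
      · split_ifs with h <;> simp [h]
      · exact congrArg _ (hNlaw 0 n)
    · exact congrArg _ hsum
  · rw [Set.disjoint_left]
    rintro ω ⟨h1, -⟩ ⟨h2, -⟩
    omega
  · exact (hνmeas 1).inter (hNmeas {x | x.1 = n})
  · rw [Set.disjoint_left]
    rintro ω (⟨h1, -⟩ | ⟨h1, -⟩) ⟨h2, -⟩ <;> omega
  · exact (hνmeas 2).inter (hNmeas {x | x.1 + x.2 = n})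

end Evolution

/-! ### The generating function of a quadratic recursion -/

lemma catalan_eq_Gamma (n : ℕ) :
    (catalan n : ℝ) = 4 ^ n * Real.Gamma (n + 1 / 2) / (Real.sqrt Real.pi * Real.Gamma (n + 2)) := by
  have hpi : Real.sqrt Real.pi ≠ 0 := (Real.sqrt_pos.2 Real.pi_pos).ne'
  induction n with
  | zero =>
    rw [Nat.cast_zero, zero_add, zero_add, Real.Gamma_one_half_eq, Real.Gamma_two]
    simp [hpi]
  | succ n ih =>
    have h1 : ((n : ℝ) + 2) * catalan (n + 1) = 2 * (2 * n + 1) * catalan n := by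
      have e1 := succ_mul_catalan_eq_centralBinom n
      have e2 := succ_mul_catalan_eq_centralBinom (n + 1)
      have e3 := Nat.succ_mul_centralBinom_succ n
      rw [← e1, ← e2] at e3
      have e4 : (n + 1) * ((n + 1 + 1) * catalan (n + 1)) =
          (n + 1) * (2 * (2 * n + 1) * catalan n) := by rw [e3]; ring
      have := Nat.eq_of_mul_eq_mul_left n.succ_pos e4
      exact_mod_cast this
    have hn : (n : ℝ) + 2 ≠ 0 := by positivity
    have hG : Real.Gamma ((n : ℝ) + 2) ≠ 0 := (Real.Gamma_pos_of_pos (by positivity)).ne'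
    have g1 : Real.Gamma ((n + 1 : ℕ) + 1 / 2 : ℝ) = (n + 1 / 2) * Real.Gamma (n + 1 / 2) := by
      rw [← Real.Gamma_add_one (by positivity)]; congr 1; push_cast; ring
    have g2 : Real.Gamma ((n + 1 : ℕ) + 2 : ℝ) = (n + 2) * Real.Gamma (n + 2) := by
      rw [← Real.Gamma_add_one (by positivity)]; congr 1; push_cast; ring
    rw [g1, g2]
    apply mul_left_cancel₀ hn
    rw [h1, ih]
    field_simp
    ring

section Recursion

variable {p : ℕ → ℝ} {a b c : ℝ}

lemma eq_catalan_of_recursion (hb : b ≠ 1) (h0 : p 0 = 0)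
    (hrec : ∀ n, p n = (if n = 1 then a else 0) + b * p n +
      c * ∑ ij ∈ Finset.HasAntidiagonal.antidiagonal n, p ij.1 * p ij.2) (n : ℕ) :
    p (n + 1) = catalan n * (a ^ (n + 1) * c ^ n / (1 - b) ^ (2 * n + 1)) := by
  have hb' : 1 - b ≠ 0 := sub_ne_zero.2 hb.symm
  induction n using Nat.strong_induction_on with
  | _ n ih =>
    have h := hrec (n + 1)
    cases n with
    | zero =>
      simp only [zero_add, if_true, Finset.Nat.sum_antidiagonal_succ, Finset.Nat.antidiagonal_zero,
        Finset.sum_singleton, h0] at h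
      simp only [zero_add, catalan_zero, Nat.cast_one, one_mul, pow_one, pow_zero, mul_one,
        mul_zero]
      rw [eq_div_iff hb']
      linarith
    | succ m =>
      rw [Finset.Nat.sum_antidiagonal_succ, Finset.Nat.sum_antidiagonal_succ', h0] at h
      have hs : ∑ ij ∈ Finset.HasAntidiagonal.antidiagonal m, p (ij.1 + 1) * p (ij.2 + 1) =
          catalan (m + 1) * (a ^ (m + 2) * c ^ m / (1 - b) ^ (2 * m + 2)) := by
        rw [catalan_succ', Nat.cast_sum, Finset.sum_mul]
        refine Finset.sum_congr rfl fun ij hij => ?_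
        have hij' := Finset.HasAntidiagonal.mem_antidiagonal.1 hij
        rw [ih ij.1 (by omega), ih ij.2 (by omega), ← hij']
        field_simp
        push_cast
        ring
      rw [hs] at h
      simp only [Nat.add_eq_right, Nat.add_eq_zero_iff, one_ne_zero, and_false, if_false] at h
      apply mul_left_cancel₀ hb'
      have e : (1 - b) * p (m + 1 + 1) =
          c * (catalan (m + 1) * (a ^ (m + 2) * c ^ m / (1 - b) ^ (2 * m + 2))) := by linarith
      rw [e]
      field_simp
      ring

lemma tsum_eq_of_recursion (hp : ∀ n, 0 ≤ p n) (hs : Summable p)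
    (hrec : ∀ n, p n = (if n = 1 then a else 0) + b * p n +
      c * ∑ ij ∈ Finset.HasAntidiagonal.antidiagonal n, p ij.1 * p ij.2) {z : ℂ} (hz : ‖z‖ ≤ 1) :
    (Summable fun n => (p n : ℂ) * z ^ n) ∧ ‖∑' n, (p n : ℂ) * z ^ n‖ ≤ ∑' n, p n ∧
    ∑' n, (p n : ℂ) * z ^ n =
      a * z + b * ∑' n, (p n : ℂ) * z ^ n + c * (∑' n, (p n : ℂ) * z ^ n) ^ 2 := by
  have hle : ∀ n, ‖(p n : ℂ) * z ^ n‖ ≤ p n := fun n => by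
    rw [norm_mul, Complex.norm_real, Real.norm_of_nonneg (hp n), norm_pow]
    exact mul_le_of_le_one_right (hp n) (pow_le_one₀ (norm_nonneg _) hz)
  have hsn : Summable fun n => ‖(p n : ℂ) * z ^ n‖ :=
    hs.of_nonneg_of_le (fun _ => norm_nonneg _) hle
  refine ⟨hsn.of_norm, (norm_tsum_le_tsum_norm hsn).trans (hsn.tsum_le_tsum hle hs), ?_⟩
  have hsq : HasSum (fun n => ∑ ij ∈ Finset.HasAntidiagonal.antidiagonal n,
      (p ij.1 : ℂ) * z ^ ij.1 * ((p ij.2 : ℂ) * z ^ ij.2)) ((∑' n, (p n : ℂ) * z ^ n) ^ 2) := by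
    rw [sq, tsum_mul_tsum_eq_tsum_sum_antidiagonal_of_summable_norm hsn hsn]
    exact (summable_norm_sum_mul_antidiagonal_of_summable_norm hsn hsn).of_norm.hasSum
  have h1 : HasSum (fun n => if n = 1 then (a : ℂ) * z else 0) (a * z) := hasSum_ite_eq 1 _
  have hG := hsn.of_norm.hasSum
  refine hG.unique ((((h1.add (hG.mul_left (b : ℂ))).add (hsq.mul_left (c : ℂ)))).congr_fun ?_)
  intro n
  have e : ∑ ij ∈ Finset.HasAntidiagonal.antidiagonal n,
      (p ij.1 : ℂ) * z ^ ij.1 * ((p ij.2 : ℂ) * z ^ ij.2) =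
      ((∑ ij ∈ Finset.HasAntidiagonal.antidiagonal n, p ij.1 * p ij.2 : ℝ) : ℂ) * z ^ n := by
    push_cast
    rw [Finset.sum_mul]
    refine Finset.sum_congr rfl fun ij hij => ?_
    rw [← Finset.HasAntidiagonal.mem_antidiagonal.1 hij, pow_add]
    ring
  rw [e]
  conv_lhs => rw [hrec n]
  by_cases h : n = 1
  · simp only [h, if_true]; push_cast; ring
  · simp only [h, if_false]; push_cast; ring

lemma sum_sum_antidiagonal_le_sq (hp : ∀ n, 0 ≤ p n) (h0 : p 0 = 0) (n : ℕ) :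
    ∑ k ∈ Finset.range (n + 1), ∑ ij ∈ Finset.HasAntidiagonal.antidiagonal k, p ij.1 * p ij.2 ≤
      (∑ k ∈ Finset.range n, p k) ^ 2 := by
  rw [← Finset.sum_biUnion, sq, Finset.sum_mul_sum, ← Finset.sum_product',
    ← Finset.sum_filter_ne_zero]
  · refine Finset.sum_le_sum_of_subset_of_nonneg ?_ fun ij _ _ => mul_nonneg (hp _) (hp _)
    rintro ⟨i, j⟩ hij
    simp only [Finset.mem_filter, Finset.mem_biUnion, Finset.mem_range,
      Finset.HasAntidiagonal.mem_antidiagonal, Finset.mem_product] at hij ⊢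
    obtain ⟨⟨k, hk, hk'⟩, h⟩ := hij
    have hi : i ≠ 0 := fun h' => h (by rw [h', h0, zero_mul])
    have hj : j ≠ 0 := fun h' => h (by rw [h', h0, mul_zero])
    omega
  · intro i _ j _ hij
    rw [Function.onFun, Finset.disjoint_left]
    intro x hx hx'
    rw [Finset.HasAntidiagonal.mem_antidiagonal] at hx hx'
    exact hij (hx.symm.trans hx')

/-- The sum of a solution of the recursion is the least nonnegative fixed point. -/
lemma tsum_le_of_fixedPoint (ha : 0 ≤ a) (hc : 0 ≤ c) (hb : b < 1)
    (hp : ∀ n, 0 ≤ p n) (h0 : p 0 = 0)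
    (hrec : ∀ n, p n = (if n = 1 then a else 0) + b * p n +
      c * ∑ ij ∈ Finset.HasAntidiagonal.antidiagonal n, p ij.1 * p ij.2)
    {s : ℝ} (hs0 : 0 ≤ s) (hs : s = a + b * s + c * s ^ 2) : ∑' n, p n ≤ s := by
  refine Real.tsum_le_of_sum_range_le hp fun n => ?_
  induction n with
  | zero => simpa using hs0
  | succ n ih =>
    have h1 : ∑ k ∈ Finset.range (n + 1), p k =
        ∑ k ∈ Finset.range (n + 1), (if k = 1 then a else 0) + b * ∑ k ∈ Finset.range (n + 1), p k +
        c * ∑ k ∈ Finset.range (n + 1),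
          ∑ ij ∈ Finset.HasAntidiagonal.antidiagonal k, p ij.1 * p ij.2 := by
      rw [Finset.mul_sum, Finset.mul_sum, ← Finset.sum_add_distrib, ← Finset.sum_add_distrib]
      exact Finset.sum_congr rfl fun k _ => hrec k
    have h2 : ∑ k ∈ Finset.range (n + 1), (if k = 1 then a else 0) ≤ a := by
      rw [Finset.sum_ite_eq']; split_ifs <;> simp [ha]
    have h3 := mul_le_mul_of_nonneg_left ((sum_sum_antidiagonal_le_sq hp h0 n).trans
      (pow_le_pow_left₀ (Finset.sum_nonneg fun k _ => hp k) ih 2)) hc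
    refine le_of_mul_le_mul_left ?_ (sub_pos.2 hb)
    linarith

lemma cpow_half_eq_of_sq_eq {w v : ℂ} (h : w ^ 2 = v) (hw : 0 ≤ w.re) (hv : 0 ≤ v.re) :
    v ^ (1 / 2 : ℂ) = w := by
  rw [one_div, ← h]
  rcases hw.lt_or_eq with hw | hw
  · exact Complex.sq_cpow_two_inv hw
  · have h1 : v.re = w.re * w.re - w.im * w.im := by rw [← h, sq, Complex.mul_re]
    have h2 : w.im = 0 := by
      rw [← hw] at h1
      nlinarith [mul_self_nonneg w.im, mul_self_eq_zero.1 (show w.im * w.im = 0 by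
        nlinarith [mul_self_nonneg w.im])]
    have : w = 0 := Complex.ext hw.symm h2
    simp [this]

lemma hasSum_genFun_of_recursion (ha : 0 ≤ a) (hc : 0 < c) (habc : a + b + c = 1)
    (hp : ∀ n, 0 ≤ p n) (h0 : p 0 = 0) (hsum : Summable p)
    (hrec : ∀ n, p n = (if n = 1 then a else 0) + b * p n +
      c * ∑ ij ∈ Finset.HasAntidiagonal.antidiagonal n, p ij.1 * p ij.2) {z : ℂ} (hz : ‖z‖ ≤ 1) :
    HasSum (fun n : ℕ => (p n : ℂ) * z ^ n)
      (1 + 1 / (2 * c) * (1 - b - 2 * c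
        - (1 - b) * (1 - 4 * c * a / (1 - b) ^ 2 * z) ^ (1 / 2 : ℂ))) := by
  obtain ⟨hs, hn, hG⟩ := tsum_eq_of_recursion hp hsum hrec hz
  set G := ∑' n, (p n : ℂ) * z ^ n with hGdef
  have hb : 0 < 1 - b := by linarith
  have hbC : (1 - b : ℂ) ≠ 0 := by exact_mod_cast hb.ne'
  have hcC : (c : ℂ) ≠ 0 := by exact_mod_cast hc.ne'
  have hT1 := tsum_le_of_fixedPoint ha hc.le (by linarith) hp h0 hrec zero_le_one (by linarith)
  have hT2 := tsum_le_of_fixedPoint ha hc.le (by linarith) hp h0 hrec (div_nonneg ha hc.le) (by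
    field_simp
    linear_combination (-a) * habc)
  have hGre : 2 * c * G.re ≤ 1 - b := by
    have h1 : G.re ≤ 1 := (Complex.re_le_norm G).trans (hn.trans hT1)
    have h2 : G.re ≤ a / c := (Complex.re_le_norm G).trans (hn.trans hT2)
    rw [le_div_iff₀ hc] at h2
    nlinarith
  have hroot : (1 - 4 * c * a / (1 - b) ^ 2 * z : ℂ) ^ (1 / 2 : ℂ) = 1 - 2 * c * G / (1 - b) := by
    refine cpow_half_eq_of_sq_eq ?_ ?_ ?_
    · field_simp
      linear_combination (-4 * c) * hG
    · have e : (1 - 2 * c * G / (1 - b) : ℂ) = 1 - ((2 * c / (1 - b) : ℝ) : ℂ) * G := by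
        push_cast; ring
      rw [e, Complex.sub_re, Complex.one_re, Complex.re_ofReal_mul, div_mul_eq_mul_div, sub_nonneg,
        div_le_one hb]
      exact hGre
    · have e : (1 - 4 * c * a / (1 - b) ^ 2 * z : ℂ) =
          1 - ((4 * c * a / (1 - b) ^ 2 : ℝ) : ℂ) * z := by push_cast; ring
      have hκ : 4 * c * a / (1 - b) ^ 2 ≤ 1 := by
        rw [div_le_one (by positivity), ← habc]
        nlinarith [sq_nonneg (a - c)]
      have hκ0 : 0 ≤ 4 * c * a / (1 - b) ^ 2 := by positivity
      have hzre : z.re ≤ 1 := (Complex.re_le_norm z).trans hz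
      rw [e, Complex.sub_re, Complex.one_re, Complex.re_ofReal_mul]
      nlinarith
  have : (1 + 1 / (2 * c) * (1 - b - 2 * c
      - (1 - b) * (1 - 4 * c * a / (1 - b) ^ 2 * z) ^ (1 / 2 : ℂ)) : ℂ) = G := by
    rw [hroot]
    field_simp
    ring
  rw [this]
  exact hs.hasSum

lemma tsum_of_recursion (ha : 0 ≤ a) (hc : 0 ≤ c) (habc : a + b + c = 1)
    (hb : b ≠ 1) (hp : ∀ n, 0 ≤ p n) (h0 : p 0 = 0) (hsum : Summable p)
    (hrec : ∀ n, p n = (if n = 1 then a else 0) + b * p n +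
      c * ∑ ij ∈ Finset.HasAntidiagonal.antidiagonal n, p ij.1 * p ij.2) :
    (c ≤ a → ∑' n, p n = 1) ∧ (a < c → ∑' n, p n = a / c) := by
  have hb' : b < 1 := lt_of_le_of_ne (by linarith) hb
  have hT : ∑' n, p n = a + b * ∑' n, p n + c * (∑' n, p n) ^ 2 := by
    have := (tsum_eq_of_recursion hp hsum hrec (z := 1) (by simp)).2.2
    simp only [one_pow, mul_one, ← Complex.ofReal_tsum] at this
    exact_mod_cast this
  have hT1 := tsum_le_of_fixedPoint ha hc hb' hp h0 hrec zero_le_one (by linarith)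
  set T := ∑' n, p n
  have hfac : (T - 1) * (c * T - a) = 0 := by
    linear_combination (-1 : ℝ) * hT - T * habc
  constructor
  · intro hca
    rcases mul_eq_zero.1 hfac with h | h
    · linarith
    · by_contra hne
      have hlt : T < 1 := lt_of_le_of_ne hT1 hne
      rcases hc.lt_or_eq with hc' | hc'
      · nlinarith
      · rw [← hc', zero_mul] at h
        exact hb (by linarith)
  · intro hac
    have hc' : 0 < c := ha.trans_lt hac
    have hT2 := tsum_le_of_fixedPoint ha hc hb' hp h0 hrec (div_nonneg ha hc) (by
      field_simp
      linear_combination (-a) * habc)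
    have h1 : a / c < 1 := (div_lt_one hc').2 hac
    rcases mul_eq_zero.1 hfac with h | h
    · linarith
    · rw [eq_div_iff hc'.ne']; linarith

end Recursion

/-! ### Factorial moments and the final theorem -/

lemma IsTruncated.genFun_eq {f : ℕ → ℝ} (hf : IsTruncated f) :
    genFun f = fun z => f 0 + f 1 * z + f 2 * z ^ 2 := by
  funext z
  rw [genFun, tsum_eq_sum (s := Finset.range 3)]
  · simp [Finset.sum_range_succ]
  · intro k hk
    rw [hf.eq_zero k (by simpa using hk), zero_mul]

lemma IsTruncated.deriv_genFun {f : ℕ → ℝ} (hf : IsTruncated f) :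
    deriv (genFun f) = fun z => f 1 + 2 * f 2 * z := by
  funext z
  rw [hf.genFun_eq]
  have h := (((hasDerivAt_id' z).const_mul (f 1)).const_add (f 0)).fun_add
    (((hasDerivAt_id' z).fun_pow 2).const_mul (f 2))
  rw [h.deriv]
  norm_num
  ring

lemma IsTruncated.factorialMoment_one {f : ℕ → ℝ} (hf : IsTruncated f) :
    factorialMoment f 1 = f 1 + 2 * f 2 := by
  rw [factorialMoment, iteratedDeriv_one, hf.deriv_genFun]
  ring

lemma IsTruncated.factorialMoment_two {f : ℕ → ℝ} (hf : IsTruncated f) :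
    factorialMoment f 2 = 2 * f 2 := by
  rw [factorialMoment, iteratedDeriv_succ, iteratedDeriv_one, hf.deriv_genFun]
  simp

lemma hasSum_measureReal_eq_natCast {Ω : Type*} [MeasurableSpace Ω] {P : Measure Ω}
    [IsProbabilityMeasure P] {N : Ω → ℕ∞} (hN : Measurable N) :
    HasSum (fun n : ℕ => P.real {ω | N ω = n}) (1 - P.real {ω | N ω = ⊤}) := by
  have hm : ∀ x : ℕ∞, MeasurableSet {ω | N ω = x} := fun x => hN (measurableSet_singleton x)
  have hU : {ω | N ω = ⊤}ᶜ = ⋃ n : ℕ, {ω | N ω = n} := by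
    ext ω
    simp only [Set.mem_compl_iff, Set.mem_ofPred_eq, Set.mem_iUnion, ← ne_eq,
      ENat.ne_top_iff_exists, eq_comm]
  have hd : Pairwise (Function.onFun Disjoint fun n : ℕ => {ω | N ω = n}) := fun i j hij => by
    rw [Function.onFun, Set.disjoint_left]
    intro ω h1 h2
    exact hij (by exact_mod_cast (show (N ω = i) from h1).symm.trans h2)
  have hadd := measure_iUnion (μ := P) hd fun n => hm n
  rw [← probReal_compl_eq_one_sub (hm ⊤), hU, measureReal_def, hadd,
    ENNReal.tsum_toReal_eq fun n => measure_ne_top _ _]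
  exact ENNReal.hasSum_toReal (hadd ▸ measure_ne_top _ _)

end RandomTree

theorem mainTheorem7 {Ω : Type*} [MeasurableSpace Ω] (P : Measure Ω) [IsProbabilityMeasure P]
    (Q : ℝ) (hQ : 0 < Q) (f : ℕ → ℝ) (hf : RandomTree.IsTruncated f) (hf1 : f 1 ≠ 1)
    (τ : List ℕ → Ω → ℝ) (ν : List ℕ → Ω → ℕ) (hev : RandomTree.IsEvolution P Q f τ ν) :
    ∃ N : Ω → ℕ∞, Measurable N ∧
      -- `N` is the number of end-nodes of the stationary tree
      (∀ᵐ ω ∂P, Tendsto (fun t : ℝ => RandomTree.endNodeCount (τ · ω) (ν · ω) t) atTop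
        (𝓝 (N ω))) ∧
      (∀ n : ℕ, Tendsto
        (fun t : ℝ => P.real {ω | RandomTree.endNodeCount (τ · ω) (ν · ω) t = n}) atTop
        (𝓝 (P.real {ω | N ω = n}))) ∧
      -- its generating function
      (f 2 ≠ 0 → ∀ z : ℂ, ‖z‖ ≤ 1 →
        HasSum (fun n : ℕ => (P.real {ω | N ω = n} : ℂ) * z ^ n)
          (1 + 1 / (2 * f 2) * (1 - f 1 - 2 * f 2
            - (1 - f 1) * (1 - 4 * f 2 * f 0 / (1 - f 1) ^ 2 * z) ^ (1 / 2 : ℂ)))) ∧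
      -- its distribution
      P.real {ω | N ω = 0} = 0 ∧
      (∀ n : ℕ, 1 ≤ n → P.real {ω | N ω = n} =
        1 / Real.sqrt Real.pi * f 0 * (Real.Gamma ((n : ℝ) - 1 / 2) / Real.Gamma ((n : ℝ) + 1)) *
          ((4 * f 0 * f 2) ^ (n - 1) / (1 - f 1) ^ (2 * n - 1))) ∧
      -- the probability of infinitely many end-nodes
      (RandomTree.factorialMoment f 1 ≤ 1 → P.real {ω | N ω = ⊤} = 0) ∧
      (1 < RandomTree.factorialMoment f 1 → P.real {ω | N ω = ⊤} =
        2 * (RandomTree.factorialMoment f 1 - 1) / RandomTree.factorialMoment f 2) := by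
  have hm : Measurable fun ω => RandomTree.finalCount (ν · ω) :=
    RandomTree.measurable_finalCount.comp (measurable_pi_lambda _ hev.measurable_offspring)
  have hsum := RandomTree.hasSum_measureReal_eq_natCast (P := P) hm
  have hrec := hev.measureReal_finalCount hf
  have h0 : P.real {ω | RandomTree.finalCount (ν · ω) = (0 : ℕ)} = 0 := by
    simp [RandomTree.finalCount]
  have hp : ∀ n : ℕ, 0 ≤ P.real {ω | RandomTree.finalCount (ν · ω) = n} :=
    fun n => measureReal_nonneg
  have hT := RandomTree.tsum_of_recursion (hf.nonneg 0) (hf.nonneg 2)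
    hf.sum_eq_one hf1 hp h0 hsum.summable hrec
  rw [hsum.tsum_eq] at hT
  have hs := hf.sum_eq_one
  refine ⟨_, hm, hev.ae_tendsto_endNodeCount hf, hev.tendsto_measureReal_endNodeCount hf,
    fun h2 z hz => ?_, by exact_mod_cast h0, fun n hn => ?_, fun hq => ?_, fun hq => ?_⟩
  · exact RandomTree.hasSum_genFun_of_recursion (hf.nonneg 0)
      ((hf.nonneg 2).lt_of_ne' h2) hs hp h0 hsum.summable hrec hz
  · obtain ⟨m, rfl⟩ := Nat.exists_eq_add_of_le' hn
    rw [RandomTree.eq_catalan_of_recursion hf1 h0 hrec m, RandomTree.catalan_eq_Gamma,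
      show ((m + 1 : ℕ) : ℝ) - 1 / 2 = m + 1 / 2 by push_cast; ring,
      show ((m + 1 : ℕ) : ℝ) + 1 = m + 2 by push_cast; ring, Nat.add_sub_cancel,
      show 2 * (m + 1) - 1 = 2 * m + 1 by omega]
    field_simp
    ring
  · rw [hf.factorialMoment_one] at hq
    linarith [hT.1 (by linarith)]
  · rw [hf.factorialMoment_one] at hq ⊢
    rw [hf.factorialMoment_two]
    have h2 : 0 < f 2 := (hf.nonneg 0).trans_lt (by linarith)
    have h := hT.2 (by linarith)
    rw [eq_div_iff h2.ne'] at h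
    rw [eq_div_iff (by positivity)]
    linear_combination (-2 : ℝ) * h - 2 * hs
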